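/- Let $K$ be a field. A weighted oriented graph $D$ on a finite vertex set $V=\{x_1,\dots,x_n\}$ consists of a set $E(D)\subseteq V\times V$ of directed edges such that $(x_i,x_j)\in E(D)$ implies $(x_j,x_i)\notin E(D)$ (in particular there are no loops), together with a weight function $w:V\to\mathbb{N}\setminus\{0\}$. Its underlying graph is the simple graph $G$ on $V$ with edges $\{x_i,x_j\}$ for $(x_i,x_j)\in E(D)$. The edge ideal of $D$ is $$I(D)=\left(x_i x_j^{w(x_j)} : (x_i,x_j)\in E(D)\right)\subseteq A=K[x_1,\dots,x_n],$$ and $D$ is called Cohen–Macaulay (over $K$) if $A/I(D)$ is a Cohen–Macaulay ring, that is, a Noetherian ring all of whose localizations at prime ideals have depth equal to their Krull dimension. If $D$ is a Cohen–Macaulay weighted oriented graph whose underlying graph $G$ is a cycle (that is, $G\cong C_m$ for some $m\ge 3$, where $C_m$ denotes the cycle of length $m$), then $G\cong C_3$ or $G\cong C_5$. -/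

import Mathlib

/-- The depth of a local ring: the supremum of the lengths of the regular sequences
contained in the maximal ideal. -/
noncomputable def localRingDepth (R : Type*) [CommRing R] [IsLocalRing R] : ℕ∞ :=
  sSup {n : ℕ∞ | ∃ rs : List R, (∀ r ∈ rs, r ∈ IsLocalRing.maximalIdeal R) ∧
    RingTheory.Sequence.IsRegular R rs ∧ n = (rs.length : ℕ∞)}

/-- A Cohen-Macaulay local ring: a Noetherian local ring whose depth equals its Krull dimension. -/
structure IsCohenMacaulayLocal (R : Type*) [CommRing R] [IsLocalRing R] : Prop where
  noetherian : IsNoetherianRing R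
  depth_eq_dim : (localRingDepth R : WithBot ℕ∞) = ringKrullDim R

/-- A Cohen-Macaulay ring: a Noetherian ring all of whose localizations at prime ideals are
Cohen-Macaulay local rings. -/
structure IsCohenMacaulay (R : Type*) [CommRing R] : Prop where
  noetherian : IsNoetherianRing R
  localization : ∀ (p : Ideal R) [p.IsPrime], IsCohenMacaulayLocal (Localization.AtPrime p)

/-- A weighted oriented graph on the vertex set `V`: `Adj u v` says that `(u, v)` is a directed
edge from `u` to `v`. Every edge has exactly one direction (in particular there are no loops), and
every vertex carries a positive integer weight. -/
structure WeightedOrientedGraph (V : Type*) extends Digraph V where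
  asymm : ∀ u v, Adj u v → ¬ Adj v u
  weight : V → ℕ
  weight_pos : ∀ v, 0 < weight v

namespace WeightedOrientedGraph

/-- The underlying simple graph, obtained by forgetting directions and weights. -/
def underlyingGraph {V : Type*} (D : WeightedOrientedGraph V) : SimpleGraph V :=
  D.toDigraph.toSimpleGraphInclusive

/-- The edge ideal, generated by the monomials `x_u * x_v ^ w(v)` for the directed edges `(u, v)`,
in the polynomial ring over `K` with one variable for each vertex. -/
noncomputable def edgeIdeal {V : Type*} (D : WeightedOrientedGraph V) (K : Type*) [Field K] :
    Ideal (MvPolynomial V K) :=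
  Ideal.span {f | ∃ u v, D.Adj u v ∧ f = MvPolynomial.X u * MvPolynomial.X v ^ D.weight v}

/-- `D` is Cohen-Macaulay over `K` if the quotient of the polynomial ring by the edge ideal is a
Cohen-Macaulay ring. -/
def CohenMacaulay {V : Type*} (D : WeightedOrientedGraph V) (K : Type*) [Field K] : Prop :=
  IsCohenMacaulay (MvPolynomial V K ⧸ D.edgeIdeal K)

end WeightedOrientedGraph

/-! Let `N` bound all weights. Then `X u ^ N * X v ^ N` lies in the edge ideal for every edge `uv`,
so orientation and weights drop out and the independence complex of `G` decides. Its faces `σ` give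
primes `facePrime`, and chains of faces bound their heights from below.

A simplicial cochain on the link of `σ`, multiplied by the powers `X i ^ N`, becomes a Koszul
cochain over the localization at `σ`. Depth at least 2 (resp. 3) kills Koszul cohomology in degree 1
(resp. 2), and reading off one coefficient turns the Koszul primitive into a simplicial one. So
Cohen–Macaulayness makes links of positive dimension connected, and forces H¹ = 0 for an
independence complex of dimension at least 2: Reisner's criterion in low degrees.

For `n = 4` the complex is two disjoint edges. For `n ≥ 6`, `n ≠ 7`, some face has as link an edge
plus an isolated point. For `n = 7` the complex contains a triangle and has H¹ ≠ 0. -/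

open MvPolynomial

/-! ### Koszul cohomology in degrees 0, 1, 2 -/

section Koszul

variable {R : Type*} [CommRing R] {ι : Type*} [Fintype ι] {f : ι → R}

open RingTheory.Sequence

/-- Vanishing of the zeroth Koszul cohomology on modules of depth at least one. -/
theorem eq_zero_of_isWeaklyRegular {M : Type*} [AddCommGroup M] [Module R M] {r : R} {rs : List R}
    (hr : r ∈ (Ideal.span (Set.range f)).radical)
    (hreg : IsWeaklyRegular M (r :: rs)) {m : M} (hm : ∀ i, f i • m = 0) : m = 0 := by
  obtain ⟨n, hn⟩ := hr
  obtain ⟨c, hc⟩ := Ideal.mem_span_range_iff_exists_fun.1 hn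
  have h1 := ((isWeaklyRegular_cons_iff M r rs).1 hreg).1.pow n
  refine h1.right_eq_zero_of_smul ?_
  rw [← hc, Finset.sum_smul]
  exact Finset.sum_eq_zero fun i _ => by rw [mul_smul, hm, smul_zero]

/-- Vanishing of the first Koszul cohomology on modules of depth at least two. -/
theorem exists_eq_smul_of_isWeaklyRegular {M : Type*} [AddCommGroup M] [Module R M] {r s : R}
    {rs : List R} (hr : r ∈ (Ideal.span (Set.range f)).radical)
    (hs : s ∈ (Ideal.span (Set.range f)).radical)
    (hreg : IsWeaklyRegular M (r :: s :: rs)) {a : ι → M}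
    (ha : ∀ i j, f i • a j = f j • a i) : ∃ b : M, ∀ i, a i = f i • b := by
  obtain ⟨n, hn⟩ := hr
  obtain ⟨c, hc⟩ := Ideal.mem_span_range_iff_exists_fun.1 hn
  obtain ⟨h1, h2⟩ := (isWeaklyRegular_cons_iff M r _).1 hreg
  have key : ∃ b : M, ∀ i, r ^ n • a i = f i • b := by
    -- Contraction with `c`, where `r ^ n = ∑ c j * f j`, is a homotopy from multiplication by `r ^
    -- n` to zero.
    refine ⟨∑ j, c j • a j, fun i => ?_⟩
    rw [← hc, Finset.sum_smul, Finset.smul_sum]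
    refine Finset.sum_congr rfl fun j _ => ?_
    rw [mul_smul, ← ha i j, smul_comm]
  clear hc hn
  induction n with
  | zero => simpa using key
  | succ n ih =>
    obtain ⟨b, hb⟩ := key
    refine ih ?_
    -- Modulo `r` the primitive `b` is a cocycle one degree lower, hence zero; so `r` divides `b`
    -- and one factor `r` cancels.
    have hb0 : (Submodule.Quotient.mk b : QuotSMulTop r M) = 0 := by
      refine eq_zero_of_isWeaklyRegular hs h2 fun i => ?_
      rw [← Submodule.Quotient.mk_smul, Submodule.Quotient.mk_eq_zero, ← hb i, pow_succ', mul_smul]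
      exact Submodule.smul_mem_pointwise_smul _ _ _ trivial
    rw [Submodule.Quotient.mk_eq_zero] at hb0
    obtain ⟨b', -, rfl⟩ := hb0
    refine ⟨b', fun i => h1 ?_⟩
    have := hb i
    simp only [DistribSMul.toLinearMap_apply] at this ⊢
    rw [smul_comm r (f i), ← this, pow_succ', mul_smul]

/-- Vanishing of the second Koszul cohomology on modules of depth at least three. -/
theorem exists_eq_smul_sub_smul_of_isWeaklyRegular {M : Type*} [AddCommGroup M] [Module R M]
    {r s t : R} {rs : List R} (hr : r ∈ (Ideal.span (Set.range f)).radical)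
    (hs : s ∈ (Ideal.span (Set.range f)).radical)
    (ht : t ∈ (Ideal.span (Set.range f)).radical)
    (hreg : IsWeaklyRegular M (r :: s :: t :: rs)) {a : ι → ι → M}
    (ha : ∀ i j k, f k • a i j - f j • a i k + f i • a j k = 0)  :
    ∃ b : ι → M, ∀ i j, a i j = f i • b j - f j • b i := by
  obtain ⟨n, hn⟩ := hr
  obtain ⟨c, hc⟩ := Ideal.mem_span_range_iff_exists_fun.1 hn
  obtain ⟨h1, h2⟩ := (isWeaklyRegular_cons_iff M r _).1 hreg
  have key : ∃ b : ι → M, ∀ i j, r ^ n • a i j = f i • b j - f j • b i := by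
    -- The same homotopy; contracting the second index causes the sign.
    refine ⟨fun i => - ∑ k, c k • a i k, fun i j => ?_⟩
    rw [← hc, Finset.sum_smul]
    simp only [smul_neg, Finset.smul_sum, ← Finset.sum_neg_distrib]
    rw [← Finset.sum_sub_distrib]
    refine Finset.sum_congr rfl fun k _ => ?_
    have h := congrArg (c k • ·) (ha i j k)
    simp only [smul_add, smul_sub, smul_zero] at h
    rw [mul_smul, smul_comm (f i), smul_comm (f j), ← sub_eq_zero, ← h]
    abel
  clear hc hn
  induction n with
  | zero => simpa using key
  | succ n ih =>
    obtain ⟨b, hb⟩ := key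
    refine ih ?_
    -- Modulo `r` the primitive is a 1-cocycle, so it is a coboundary; subtracting a lift `f i • d`
    -- leaves a multiple of `r`.
    obtain ⟨d, hd⟩ : ∃ d : QuotSMulTop r M, ∀ i, Submodule.Quotient.mk (b i) = f i • d := by
      refine exists_eq_smul_of_isWeaklyRegular hs ht h2 fun i j => ?_
      rw [← Submodule.Quotient.mk_smul, ← Submodule.Quotient.mk_smul, Submodule.Quotient.eq,
        ← hb i j, pow_succ', mul_smul]
      exact Submodule.smul_mem_pointwise_smul _ _ _ trivial
    obtain ⟨d, rfl⟩ := Submodule.Quotient.mk_surjective _ d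
    have hb' : ∀ i, ∃ b', b i = f i • d + r • b' := by
      intro i
      have := hd i
      rw [← Submodule.Quotient.mk_smul, Submodule.Quotient.eq] at this
      obtain ⟨b', -, hb'⟩ := this
      exact ⟨b', by rw [← sub_eq_iff_eq_add', ← hb']; rfl⟩
    choose b' hb' using hb'
    refine ⟨b', fun i j => h1 ?_⟩
    have := hb i j
    simp only [hb' i, hb' j, smul_add, pow_succ', mul_smul] at this
    simp only [smul_sub]
    rw [this, smul_comm (f i) (f j), smul_comm (f i) r, smul_comm (f j) r]
    abel

end Koszul

/-! ### Long regular sequences from the dimension -/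

section CohenMacaulay

variable {R : Type*} [CommRing R] [IsLocalRing R]

/-- A Cohen-Macaulay local ring of dimension at least `d + 1` has a regular sequence of length
at least `d + 1` in its maximal ideal. -/
theorem IsCohenMacaulayLocal.exists_isRegular (h : IsCohenMacaulayLocal R) {d : ℕ}
    (hd : ((d + 1 : ℕ) : WithBot ℕ∞) ≤ ringKrullDim R) :
    ∃ rs : List R, (∀ r ∈ rs, r ∈ IsLocalRing.maximalIdeal R) ∧
      RingTheory.Sequence.IsRegular R rs ∧ d + 1 ≤ rs.length := by
  rw [← h.depth_eq_dim] at hd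
  have hd' : ((d + 1 : ℕ) : ℕ∞) ≤ localRingDepth R := by exact_mod_cast hd
  have : ((d : ℕ) : ℕ∞) < localRingDepth R :=
    lt_of_lt_of_le (by exact_mod_cast Nat.lt_succ_self d) hd'
  obtain ⟨_, ⟨rs, h1, h2, rfl⟩, h3⟩ := lt_sSup_iff.1 this
  exact ⟨rs, h1, h2, by exact_mod_cast h3⟩

end CohenMacaulay

/-! ### Monomial primes attached to vertex sets -/

section FaceIdeal

variable {V K : Type*} [Field K]

/-- The prime ideal generated by the variables outside of `S`. -/
noncomputable def faceIdeal (K : Type*) [Field K] (S : Set V) : Ideal (MvPolynomial V K) :=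
  Ideal.span (X '' Sᶜ)

theorem mem_faceIdeal {S : Set V} {f : MvPolynomial V K} :
    f ∈ faceIdeal K S ↔ ∀ m : V →₀ ℕ, (∀ v, m v ≠ 0 → v ∈ S) → coeff m f = 0 := by
  rw [faceIdeal, mem_ideal_span_X_image]
  refine forall_congr' fun m => ?_
  simp only [mem_support_iff, Set.mem_compl_iff]
  constructor
  · intro h h2
    by_contra h3
    obtain ⟨i, hi, hi'⟩ := h h3
    exact hi (h2 i hi')
  · intro h h2
    by_contra! h3
    exact h2 (h fun v hv => by_contra fun hvS => hv (h3 v hvS))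

theorem X_mem_faceIdeal_iff {S : Set V} {v : V} :
    (X v : MvPolynomial V K) ∈ faceIdeal K S ↔ v ∉ S := by
  classical
  refine ⟨fun h hv => ?_, fun h => Ideal.subset_span ⟨v, h, rfl⟩⟩
  have := mem_faceIdeal.1 h (Finsupp.single v 1) fun w hw => by
    by_contra hw'
    exact hw (Finsupp.single_eq_of_ne (by rintro rfl; exact hw' hv))
  simp at this

theorem faceIdeal_anti {S T : Set V} (h : S ⊆ T) : faceIdeal K T ≤ faceIdeal K S :=
  Ideal.span_mono (Set.image_mono (Set.compl_subset_compl.2 h))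

instance faceIdeal_isPrime (S : Set V) : (faceIdeal K S).IsPrime := by
  classical
  -- `φ` is the identity modulo `faceIdeal K S`, so its kernel is no larger than that ideal.
  let φ : MvPolynomial V K →ₐ[K] MvPolynomial V K := aeval fun v => if v ∈ S then X v else 0
  have h : faceIdeal K S = RingHom.ker φ := by
    apply le_antisymm
    · rw [faceIdeal, Ideal.span_le]
      rintro _ ⟨v, hv, rfl⟩
      simp only [SetLike.mem_coe, RingHom.mem_ker, φ, aeval_X]
      exact if_neg hv
    · intro f hf
      have h2 : (Ideal.Quotient.mkₐ K (faceIdeal K S)).comp φ =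
          Ideal.Quotient.mkₐ K (faceIdeal K S) := by
        ext v
        simp only [AlgHom.comp_apply, φ, aeval_X]
        split_ifs with hv
        · rfl
        · rw [map_zero]
          exact (Ideal.Quotient.eq_zero_iff_mem.2 (X_mem_faceIdeal_iff.2 hv)).symm
      have h3 := DFunLike.congr_fun h2 f
      rw [AlgHom.comp_apply, (RingHom.mem_ker).1 hf, map_zero] at h3
      exact Ideal.Quotient.eq_zero_iff_mem.1 h3.symm
  rw [h]
  exact RingHom.ker_isPrime _

end FaceIdeal

/-! ### Face primes of the edge ring and their localizations -/

namespace WeightedOrientedGraph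

variable {V : Type*} (D : WeightedOrientedGraph V) (K : Type*) [Field K]

theorem edgeIdeal_le_faceIdeal {S : Set V} (hS : D.underlyingGraph.IsIndepSet S) :
    D.edgeIdeal K ≤ faceIdeal K S := by
  rw [edgeIdeal, Ideal.span_le]
  rintro _ ⟨u, v, huv, rfl⟩
  have hne : u ≠ v := by
    rintro rfl
    exact D.asymm _ _ huv huv
  have hadj : D.underlyingGraph.Adj u v := ⟨hne, Or.inl huv⟩
  by_cases hu : u ∈ S
  · have hv : v ∉ S := fun hv => hS hu hv hne hadj
    exact Ideal.mul_mem_left _ _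
      (Ideal.pow_mem_of_mem _ (X_mem_faceIdeal_iff.2 hv) _ (D.weight_pos v))
  · exact Ideal.mul_mem_right _ _ (X_mem_faceIdeal_iff.2 hu)

theorem X_pow_mul_X_pow_mem_edgeIdeal {N : ℕ} (hN : ∀ v, D.weight v ≤ N) {u v : V}
    (h : D.underlyingGraph.Adj u v) : (X u ^ N * X v ^ N : MvPolynomial V K) ∈ D.edgeIdeal K := by
  have key : ∀ u v, D.Adj u v → (X u ^ N * X v ^ N : MvPolynomial V K) ∈ D.edgeIdeal K := by
    intro u v huv
    refine Ideal.mem_of_dvd _ (mul_dvd_mul (dvd_pow_self _ ?_) (pow_dvd_pow _ (hN v)))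
      (Ideal.subset_span ⟨u, v, huv, rfl⟩)
    exact ((D.weight_pos v).trans_le (hN v)).ne'
  rcases h.2 with h | h
  · exact key u v h
  · rw [mul_comm]
    exact key v u h

/-- The image of `faceIdeal K S` in the quotient by the edge ideal. -/
noncomputable def facePrime (S : Set V) : Ideal (MvPolynomial V K ⧸ D.edgeIdeal K) :=
  (faceIdeal K S).map (Ideal.Quotient.mk (D.edgeIdeal K))

variable {D K}

theorem mk_mem_facePrime_iff {S : Set V} (hS : D.underlyingGraph.IsIndepSet S)
    {f : MvPolynomial V K} :
    Ideal.Quotient.mk (D.edgeIdeal K) f ∈ D.facePrime K S ↔ f ∈ faceIdeal K S := by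
  rw [facePrime, ← Ideal.mem_comap, Ideal.comap_map_of_surjective _ Ideal.Quotient.mk_surjective,
    ← RingHom.ker_eq_comap_bot, Ideal.mk_ker, sup_eq_left.2 (D.edgeIdeal_le_faceIdeal K hS)]

theorem facePrime_isPrime {S : Set V} (hS : D.underlyingGraph.IsIndepSet S) :
    (D.facePrime K S).IsPrime :=
  Ideal.map_isPrime_of_surjective Ideal.Quotient.mk_surjective
    (by rw [Ideal.mk_ker]; exact D.edgeIdeal_le_faceIdeal K hS)

theorem facePrime_insert_lt {S : Set V} {v : V} (hv : v ∉ S)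
    (hS : D.underlyingGraph.IsIndepSet (insert v S)) :
    D.facePrime K (insert v S) < D.facePrime K S := by
  refine lt_of_le_of_ne (Ideal.map_mono (faceIdeal_anti (Set.subset_insert _ _))) fun h => ?_
  have h1 : Ideal.Quotient.mk (D.edgeIdeal K) (X v) ∈ D.facePrime K S :=
    Ideal.mem_map_of_mem _ (X_mem_faceIdeal_iff.2 hv)
  rw [← h, mk_mem_facePrime_iff hS, X_mem_faceIdeal_iff] at h1
  exact h1 (Set.mem_insert _ _)

theorem height_facePrime_insert {S : Set V} {v : V} (hv : v ∉ S)
    (hS : D.underlyingGraph.IsIndepSet (insert v S)) :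
    (D.facePrime K (insert v S)).height + 1 ≤ (D.facePrime K S).height := by
  have := facePrime_isPrime (K := K) hS
  have := facePrime_isPrime (K := K) (Set.Pairwise.mono (Set.subset_insert v S) hS)
  exact Ideal.height_add_one_le_of_lt_of_isPrime (facePrime_insert_lt hv hS)

section Localization

variable {σ : Set V} [hp : (D.facePrime K σ).IsPrime] (L : Type*) [CommRing L]
  [Algebra (MvPolynomial V K ⧸ D.edgeIdeal K) L] [IsLocalization.AtPrime L (D.facePrime K σ)]

variable (D K) in
/-- The map from the polynomial ring to an algebra over the quotient by the edge ideal. -/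
noncomputable def toLoc (L : Type*) [CommRing L]
    [Algebra (MvPolynomial V K ⧸ D.edgeIdeal K) L] : MvPolynomial V K →+* L :=
  (algebraMap (MvPolynomial V K ⧸ D.edgeIdeal K) L).comp (Ideal.Quotient.mk (D.edgeIdeal K))

omit hp [IsLocalization.AtPrime L (D.facePrime K σ)] in
theorem toLoc_X_pow_mul_X_pow {N : ℕ} (hN : ∀ v, D.weight v ≤ N) {u v : V}
    (h : D.underlyingGraph.Adj u v) : D.toLoc K L (X u ^ N) * D.toLoc K L (X v ^ N) = 0 := by
  rw [← map_mul, toLoc, RingHom.comp_apply,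
    Ideal.Quotient.eq_zero_iff_mem.2 (D.X_pow_mul_X_pow_mem_edgeIdeal K hN h), map_zero]

include hp in
theorem isUnit_toLoc (hσ : D.underlyingGraph.IsIndepSet σ) {s : MvPolynomial V K}
    (hs : s ∉ faceIdeal K σ) : IsUnit (D.toLoc K L s) :=
  IsLocalization.map_units L
    (⟨_, (mk_mem_facePrime_iff hσ).not.2 hs⟩ : (D.facePrime K σ).primeCompl)

-- Variables in `σ` become units, so the neighbours of `σ` die up to powers: only the link of `σ`
-- survives.
include hp in
theorem toLoc_X_pow_eq_zero (hσ : D.underlyingGraph.IsIndepSet σ) {N : ℕ}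
    (hN : ∀ v, D.weight v ≤ N) {u v : V} (hv : v ∈ σ) (h : D.underlyingGraph.Adj u v) :
    D.toLoc K L (X u ^ N) = 0 := by
  have hu : IsUnit (D.toLoc K L (X v ^ N)) := by
    rw [map_pow]
    exact (isUnit_toLoc L hσ (X_mem_faceIdeal_iff.not.2 (not_not.2 hv))).pow N
  exact hu.mul_left_eq_zero.1 (toLoc_X_pow_mul_X_pow L hN h)

-- A denominator avoids `faceIdeal K σ`, hence also the smaller prime `faceIdeal K S`, and primality
-- strips it off.
include hp in
theorem mem_faceIdeal_of_toLoc_eq_zero {S : Set V} (hS : D.underlyingGraph.IsIndepSet S)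
    (hσS : σ ⊆ S) {f : MvPolynomial V K} (hf : D.toLoc K L f = 0) : f ∈ faceIdeal K S := by
  rw [toLoc, RingHom.comp_apply,
    IsLocalization.map_eq_zero_iff (D.facePrime K σ).primeCompl] at hf
  obtain ⟨⟨t, ht⟩, h⟩ := hf
  obtain ⟨t, rfl⟩ := Ideal.Quotient.mk_surjective t
  rw [← map_mul, Ideal.Quotient.eq_zero_iff_mem] at h
  refine ((faceIdeal_isPrime S).mem_or_mem (D.edgeIdeal_le_faceIdeal K hS h)).resolve_left ?_
  intro h'
  exact ht (Ideal.mem_map_of_mem _ (faceIdeal_anti hσS h'))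

include hp in
theorem exists_toLoc_mul_eq (hσ : D.underlyingGraph.IsIndepSet σ) {ι : Type*} [Finite ι]
    (b : ι → L) : ∃ s ∉ faceIdeal K σ, ∃ B : ι → MvPolynomial V K,
      ∀ i, D.toLoc K L s * b i = D.toLoc K L (B i) := by
  obtain ⟨⟨s, hs⟩, h⟩ :=
    IsLocalization.exist_integer_multiples_of_finite (D.facePrime K σ).primeCompl b
  obtain ⟨s, rfl⟩ := Ideal.Quotient.mk_surjective s
  choose B hB using h
  choose B' hB' using fun i => Ideal.Quotient.mk_surjective (B i)
  refine ⟨s, fun h => hs ((mk_mem_facePrime_iff hσ).2 h), B', fun i => ?_⟩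
  rw [toLoc, RingHom.comp_apply, RingHom.comp_apply, hB', hB, Algebra.smul_def]

theorem mem_radical_span [IsLocalRing L] (N : ℕ) {r : L} (hr : r ∈ IsLocalRing.maximalIdeal L) :
    r ∈ (Ideal.span (Set.range fun i : {i // i ∉ σ} => D.toLoc K L (X i.1 ^ N))).radical := by
  rw [← IsLocalization.AtPrime.map_eq_maximalIdeal (D.facePrime K σ) L, facePrime,
    Ideal.map_map, faceIdeal, Ideal.map_span] at hr
  refine Ideal.span_le.2 ?_ hr
  rintro _ ⟨_, ⟨v, hv, rfl⟩, rfl⟩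
  refine ⟨N, Ideal.subset_span ⟨⟨v, hv⟩, ?_⟩⟩
  exact map_pow _ _ _

include hp in
/-- Depth at least two of the localization forces the link of `σ` to be connected. -/
theorem eq_of_isWeaklyRegular_of_disconnected [Finite V] [IsLocalRing L]
    (hσ : D.underlyingGraph.IsIndepSet σ) {r s : L} {rs : List L}
    (hr : r ∈ IsLocalRing.maximalIdeal L) (hs : s ∈ IsLocalRing.maximalIdeal L)
    (hreg : RingTheory.Sequence.IsWeaklyRegular L (r :: s :: rs)) {c : V → K} {u w : V}
    (hu : D.underlyingGraph.IsIndepSet (insert u σ))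
    (hw : D.underlyingGraph.IsIndepSet (insert w σ)) (hu' : u ∉ σ) (hw' : w ∉ σ)
    (hc : ∀ i j, i ∉ σ → j ∉ σ → (∀ s ∈ σ, ¬ D.underlyingGraph.Adj i s) →
      (∀ s ∈ σ, ¬ D.underlyingGraph.Adj j s) → ¬ D.underlyingGraph.Adj i j → c i = c j) :
    c w = c u := by
  classical
  obtain ⟨N, hN⟩ : ∃ N, ∀ v, D.weight v ≤ N := by
    obtain ⟨N, hN⟩ := (Set.finite_range D.weight).bddAbove
    exact ⟨N, fun v => hN ⟨v, rfl⟩⟩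
  have := Fintype.ofFinite V
  obtain ⟨b, hb⟩ := exists_eq_smul_of_isWeaklyRegular
    (f := fun i : {i // i ∉ σ} => D.toLoc K L (X i.1 ^ N))
    (a := fun i : {i // i ∉ σ} => D.toLoc K L (C (c i.1)) * D.toLoc K L (X i.1 ^ N))
    (mem_radical_span (D := D) (K := K) L N hr)
    (mem_radical_span (D := D) (K := K) L N hs) hreg (by
      rintro ⟨i, hi⟩ ⟨j, hj⟩
      simp only [smul_eq_mul]
      by_cases h1 : ∃ s ∈ σ, D.underlyingGraph.Adj i s
      · obtain ⟨s, hs, h⟩ := h1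
        rw [toLoc_X_pow_eq_zero L hσ hN hs h]; ring
      by_cases h2 : ∃ s ∈ σ, D.underlyingGraph.Adj j s
      · obtain ⟨s, hs, h⟩ := h2
        rw [toLoc_X_pow_eq_zero L hσ hN hs h]; ring
      by_cases h3 : D.underlyingGraph.Adj i j
      · have := toLoc_X_pow_mul_X_pow (K := K) L hN h3
        linear_combination (D.toLoc K L (C (c j)) - D.toLoc K L (C (c i))) * this
      · push Not at h1 h2
        rw [hc i j hi hj h1 h2 h3]; ring)
  obtain ⟨s, hs, B, hB⟩ := exists_toLoc_mul_eq (K := K) L hσ (fun _ : Unit => b)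
  have hs' := hs
  rw [mem_faceIdeal] at hs'
  push Not at hs'
  -- `m` involves only variables of `σ`, so adding `N` at `i` keeps the support inside `insert i σ`,
  -- where coefficients are visible. Comparing them shows that `c i` times a fixed nonzero scalar
  -- does not depend on `i`.
  obtain ⟨m, hm, hms⟩ := hs'
  have key : ∀ i (hi : i ∉ σ), D.underlyingGraph.IsIndepSet (insert i σ) →
      c i * coeff m s = coeff m (B ()) := by
    intro i hi hiσ
    have h0 : D.toLoc K L (C (c i) * s * X i ^ N - B () * X i ^ N) = 0 := by
      have h1 := hb ⟨i, hi⟩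
      have h2 := hB ()
      simp only [smul_eq_mul] at h1 h2
      rw [map_sub, map_mul, map_mul, map_mul, ← h2]
      linear_combination D.toLoc K L s * h1
    have h1 := mem_faceIdeal.1 (mem_faceIdeal_of_toLoc_eq_zero L hiσ (Set.subset_insert _ _) h0)
      (m + Finsupp.single i N) (by
        intro v hv
        by_cases hvi : v = i
        · exact Or.inl hvi
        · refine Or.inr (hm v ?_)
          simpa [Finsupp.single_eq_of_ne hvi] using hv)
    rw [X_pow_eq_monomial, coeff_sub, coeff_mul_monomial, coeff_mul_monomial, coeff_C_mul] at h1
    linear_combination h1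
  exact mul_right_cancel₀ hms ((key w hw' hw).trans (key u hu' hu).symm)

end Localization

/-- Depth at least three of the localization at the irrelevant ideal forces the one-dimensional
simplicial cocycles of the independence complex to be coboundaries. -/
theorem exists_eq_sub_of_isWeaklyRegular [Finite V] [hp : (D.facePrime K ∅).IsPrime]
    (L : Type*) [CommRing L] [Algebra (MvPolynomial V K ⧸ D.edgeIdeal K) L]
    [IsLocalization.AtPrime L (D.facePrime K ∅)] [IsLocalRing L] {r s t : L} {rs : List L}
    (hr : r ∈ IsLocalRing.maximalIdeal L) (hs : s ∈ IsLocalRing.maximalIdeal L)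
    (ht : t ∈ IsLocalRing.maximalIdeal L)
    (hreg : RingTheory.Sequence.IsWeaklyRegular L (r :: s :: t :: rs)) {c : V → V → K}
    (hc : ∀ i j k, ¬ D.underlyingGraph.Adj i j → ¬ D.underlyingGraph.Adj i k →
      ¬ D.underlyingGraph.Adj j k → c i j - c i k + c j k = 0) :
    ∃ β : V → K, ∀ i j, i ≠ j → ¬ D.underlyingGraph.Adj i j → c i j = β j - β i := by
  classical
  have hσ : D.underlyingGraph.IsIndepSet (∅ : Set V) := Set.pairwise_empty _
  obtain ⟨N, hN⟩ : ∃ N, ∀ v, D.weight v ≤ N := by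
    obtain ⟨N, hN⟩ := (Set.finite_range D.weight).bddAbove
    exact ⟨N, fun v => hN ⟨v, rfl⟩⟩
  have := Fintype.ofFinite V
  obtain ⟨b, hb⟩ := exists_eq_smul_sub_smul_of_isWeaklyRegular
    (f := fun i : {i // i ∉ (∅ : Set V)} => D.toLoc K L (X i.1 ^ N))
    (a := fun i j : {i // i ∉ (∅ : Set V)} =>
      D.toLoc K L (C (c i.1 j.1)) * D.toLoc K L (X i.1 ^ N) * D.toLoc K L (X j.1 ^ N))
    (mem_radical_span (D := D) (K := K) L N hr)
    (mem_radical_span (D := D) (K := K) L N hs) (mem_radical_span (D := D) (K := K) L N ht) hreg (by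
      rintro ⟨i, -⟩ ⟨j, -⟩ ⟨k, -⟩
      simp only [smul_eq_mul]
      by_cases h1 : D.underlyingGraph.Adj i j
      · have := toLoc_X_pow_mul_X_pow (K := K) L hN h1
        linear_combination (D.toLoc K L (C (c i j)) - D.toLoc K L (C (c i k)) +
          D.toLoc K L (C (c j k))) * D.toLoc K L (X k ^ N) * this
      by_cases h2 : D.underlyingGraph.Adj i k
      · have := toLoc_X_pow_mul_X_pow (K := K) L hN h2
        linear_combination (D.toLoc K L (C (c i j)) - D.toLoc K L (C (c i k)) +
          D.toLoc K L (C (c j k))) * D.toLoc K L (X j ^ N) * this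
      by_cases h3 : D.underlyingGraph.Adj j k
      · have := toLoc_X_pow_mul_X_pow (K := K) L hN h3
        linear_combination (D.toLoc K L (C (c i j)) - D.toLoc K L (C (c i k)) +
          D.toLoc K L (C (c j k))) * D.toLoc K L (X i ^ N) * this
      have := congrArg (fun x => D.toLoc K L (C x)) (hc i j k h1 h2 h3)
      simp only [map_add, map_sub, map_zero] at this
      linear_combination D.toLoc K L (X i ^ N) * D.toLoc K L (X j ^ N) *
        D.toLoc K L (X k ^ N) * this)
  obtain ⟨s, hs, B, hB⟩ := exists_toLoc_mul_eq (K := K) L hσ b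
  have hs' := hs
  rw [mem_faceIdeal] at hs'
  push Not at hs'
  obtain ⟨m, hm, hms⟩ := hs'
  refine ⟨fun i => coeff (m + Finsupp.single i N) (B ⟨i, by simp⟩) / coeff m s,
    fun i j hij hadj => ?_⟩
  have hS : D.underlyingGraph.IsIndepSet {i, j} := by
    rintro _ (rfl | rfl) _ (rfl | rfl) hne
    exacts [(hne rfl).elim, hadj, fun h => hadj h.symm, (hne rfl).elim]
  have h0 : D.toLoc K L (C (c i j) * s * X j ^ N * X i ^ N -
      (B ⟨j, by simp⟩ * X i ^ N - B ⟨i, by simp⟩ * X j ^ N)) = 0 := by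
    have h1 := hb ⟨i, by simp⟩ ⟨j, by simp⟩
    have h2 := hB ⟨i, by simp⟩
    have h3 := hB ⟨j, by simp⟩
    simp only [smul_eq_mul] at h1
    simp only [map_sub, map_mul]
    rw [← h2, ← h3]
    linear_combination D.toLoc K L s * h1
  have h1 := mem_faceIdeal.1 (mem_faceIdeal_of_toLoc_eq_zero L hS (Set.empty_subset _) h0)
    (m + Finsupp.single j N + Finsupp.single i N) (by
      intro v hv
      by_cases hvi : v = i
      · exact Or.inl hvi
      by_cases hvj : v = j
      · exact Or.inr hvj
      · refine (hm v ?_).elim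
        simpa [Finsupp.single_eq_of_ne hvi, Finsupp.single_eq_of_ne hvj] using hv)
  rw [X_pow_eq_monomial, X_pow_eq_monomial, coeff_sub, coeff_sub, coeff_mul_monomial,
    coeff_mul_monomial, coeff_mul_monomial, coeff_C_mul,
    add_right_comm m (Finsupp.single j N) (Finsupp.single i N), coeff_mul_monomial] at h1
  field_simp
  linear_combination h1

/-! ### Topological obstructions to Cohen–Macaulayness -/

/-- If the link of a face `σ` in the independence complex is disconnected and has positive
dimension, then the graph is not Cohen-Macaulay. -/
theorem not_cohenMacaulay_of_disconnected [Finite V] {σ : Set V} {c : V → K} {u v w : V}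
    (huv : D.underlyingGraph.IsIndepSet (insert u (insert v σ)))
    (hw : D.underlyingGraph.IsIndepSet (insert w σ))
    (hu' : u ∉ σ) (hv' : v ∉ σ) (hw' : w ∉ σ) (hne : u ≠ v) (hcw : c w ≠ c u)
    (hc : ∀ i j, i ∉ σ → j ∉ σ → (∀ s ∈ σ, ¬ D.underlyingGraph.Adj i s) →
      (∀ s ∈ σ, ¬ D.underlyingGraph.Adj j s) → ¬ D.underlyingGraph.Adj i j → c i = c j) :
    ¬ D.CohenMacaulay K := by
  intro hCM
  have hvσ := Set.Pairwise.mono (Set.subset_insert u _) huv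
  have hσ := Set.Pairwise.mono (Set.subset_insert v _) hvσ
  have huσ : D.underlyingGraph.IsIndepSet (insert u σ) :=
    Set.Pairwise.mono (Set.insert_subset_insert (Set.subset_insert v _)) huv
  have hp := facePrime_isPrime (K := K) hσ
  have hdim : ((1 + 1 : ℕ) : WithBot ℕ∞) ≤
      ringKrullDim (Localization.AtPrime (D.facePrime K σ)) := by
    rw [IsLocalization.AtPrime.ringKrullDim_eq_height (D.facePrime K σ)
      (Localization.AtPrime (D.facePrime K σ))]
    have h1 := height_facePrime_insert (K := K) hv' hvσ
    have h2 := height_facePrime_insert (K := K) (v := u) (by simp [hne, hu']) huv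
    have : ((1 + 1 : ℕ) : ℕ∞) ≤ (D.facePrime K σ).height := by
      refine le_trans ?_ (le_trans (add_le_add_left h2 1) h1)
      rw [add_assoc]
      exact le_add_self
    exact WithBot.coe_le_coe.2 this
  obtain ⟨rs, hmax, hreg, hlen⟩ := (hCM.localization (D.facePrime K σ)).exists_isRegular hdim
  match rs, hlen with
  | r :: s :: rs, _ =>
    exact hcw (eq_of_isWeaklyRegular_of_disconnected _ hσ (hmax r (by simp)) (hmax s (by simp))
      hreg.toIsWeaklyRegular huσ hw hu' hw' hc)

/-- If the independence complex has dimension at least two and a one-dimensional simplicial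
cocycle which is not a coboundary, then the graph is not Cohen-Macaulay. -/
theorem not_cohenMacaulay_of_cocycle [Finite V] {c : V → V → K} {u v w : V}
    (huv : u ≠ v) (huw : u ≠ w) (hvw : v ≠ w)
    (huvw : D.underlyingGraph.IsIndepSet {u, v, w})
    (hc : ∀ i j k, ¬ D.underlyingGraph.Adj i j → ¬ D.underlyingGraph.Adj i k →
      ¬ D.underlyingGraph.Adj j k → c i j - c i k + c j k = 0)
    (hc' : ∀ β : V → K, ∃ i j, i ≠ j ∧ ¬ D.underlyingGraph.Adj i j ∧ c i j ≠ β j - β i) :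
    ¬ D.CohenMacaulay K := by
  intro hCM
  have hvw' : D.underlyingGraph.IsIndepSet {v, w} :=
    Set.Pairwise.mono (Set.subset_insert u _) huvw
  have hw' : D.underlyingGraph.IsIndepSet (insert w ∅) := by simp
  have hp := facePrime_isPrime (D := D) (K := K) (Set.pairwise_empty _)
  have hdim : ((2 + 1 : ℕ) : WithBot ℕ∞) ≤
      ringKrullDim (Localization.AtPrime (D.facePrime K ∅)) := by
    rw [IsLocalization.AtPrime.ringKrullDim_eq_height (D.facePrime K ∅)
      (Localization.AtPrime (D.facePrime K ∅))]
    have h1 := height_facePrime_insert (K := K) (by simp) hw'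
    rw [insert_empty_eq] at h1
    have h2 := height_facePrime_insert (K := K) (v := v) (by simpa) hvw'
    have h3 := height_facePrime_insert (K := K) (v := u) (by simp [huv, huw]) huvw
    have : ((2 + 1 : ℕ) : ℕ∞) ≤ (D.facePrime K (∅ : Set V)).height := by
      refine le_trans ?_ (le_trans (add_le_add_left (add_le_add_left h3 1 |>.trans h2) 1) h1)
      rw [add_assoc, add_assoc]
      exact le_add_self
    exact WithBot.coe_le_coe.2 this
  obtain ⟨rs, hmax, hreg, hlen⟩ := (hCM.localization (D.facePrime K ∅)).exists_isRegular hdim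
  match rs, hlen with
  | r :: s :: t :: rs, _ =>
    obtain ⟨β, hβ⟩ := exists_eq_sub_of_isWeaklyRegular _ (hmax r (by simp)) (hmax s (by simp))
      (hmax t (by simp)) hreg.toIsWeaklyRegular hc
    obtain ⟨i, j, hij, hadj, hne⟩ := hc' β
    exact hne (hβ i j hij hadj)

end WeightedOrientedGraph

/-! ### The obstruction for each cycle length -/

theorem SimpleGraph.cycleGraph_adj_iff_val {n : ℕ} (hn : 3 ≤ n) {u v : Fin n} :
    (SimpleGraph.cycleGraph n).Adj u v ↔ u.1 + 1 = v.1 ∨ v.1 + 1 = u.1 ∨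
      (u.1 = 0 ∧ v.1 + 1 = n) ∨ (v.1 = 0 ∧ u.1 + 1 = n) := by
  have key : ∀ u v : Fin n, (u - v).val = 1 ↔ v.1 + 1 = u.1 ∨ (u.1 = 0 ∧ v.1 + 1 = n) := by
    intro u v
    rw [Fin.val_sub]
    have hu := u.2
    have hv := v.2
    rcases le_or_gt v.1 u.1 with h | h
    · rw [show n - v.1 + u.1 = (u.1 - v.1) + n by omega, Nat.add_mod_right,
        Nat.mod_eq_of_lt (by omega)]
      omega
    · rw [Nat.mod_eq_of_lt (by omega)]
      omega
  rw [SimpleGraph.cycleGraph_adj', key, key]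
  tauto

namespace WeightedOrientedGraph

variable {V : Type*} [Finite V] {K : Type*} [Field K] {D : WeightedOrientedGraph V} {n : ℕ}

/-- The independence complex consists of the disjoint edges `{0, 2}` and `{1, 3}`, separated by
parity. -/
theorem not_cohenMacaulay_of_iso_cycleGraph_four
    (e : D.underlyingGraph ≃g SimpleGraph.cycleGraph 4) : ¬ D.CohenMacaulay K := by
  have hadj : ∀ i j, D.underlyingGraph.Adj i j ↔ (SimpleGraph.cycleGraph 4).Adj (e i) (e j) :=
    fun i j => e.map_adj_iff.symm
  refine not_cohenMacaulay_of_disconnected (σ := ∅)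
    (c := fun v => if (e v).1 % 2 = 0 then 0 else 1)
    (u := e.symm 0) (v := e.symm 2) (w := e.symm 1) ?_ (by simp) (by simp) (by simp) (by simp)
    (by simp) (by simp) ?_
  · rw [insert_empty_eq]
    rintro _ (rfl | rfl) _ (rfl | rfl) hne
    all_goals first | exact (hne rfl).elim | (rw [hadj]; simp only [RelIso.apply_symm_apply]; decide)
  · intro i j _ _ _ _ h
    rw [hadj] at h
    have : ∀ a b : Fin 4, ¬ (SimpleGraph.cycleGraph 4).Adj a b → (a.1 % 2 = 0 ↔ b.1 % 2 = 0) := by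
      decide
    simp only [this _ _ h]

theorem not_cohenMacaulay_of_iso_cycleGraph_seven
    (e : D.underlyingGraph ≃g SimpleGraph.cycleGraph 7) : ¬ D.CohenMacaulay K := by
  have hadj : ∀ i j, D.underlyingGraph.Adj i j ↔ (SimpleGraph.cycleGraph 7).Adj (e i) (e j) :=
    fun i j => e.map_adj_iff.symm
  -- An integral cocycle whose sum along the closed walk 0, 2, 4, 6, 1, 3, 5, 0 is 1. A coboundary
  -- would sum to 0, so it is nontrivial over every field.
  let c : Fin 7 → Fin 7 → ℤ := fun i j =>
    if (i = 0 ∧ j = 2) ∨ (i = 0 ∧ j = 4) ∨ (i = 5 ∧ j = 2) then 1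
    else if (j = 0 ∧ i = 2) ∨ (j = 0 ∧ i = 4) ∨ (j = 5 ∧ i = 2) then -1 else 0
  have hc : ∀ i j k, ¬ (SimpleGraph.cycleGraph 7).Adj i j → ¬ (SimpleGraph.cycleGraph 7).Adj i k →
      ¬ (SimpleGraph.cycleGraph 7).Adj j k → c i j - c i k + c j k = 0 := by decide
  refine not_cohenMacaulay_of_cocycle (c := fun i j => (c (e i) (e j) : K))
    (u := e.symm 0) (v := e.symm 2) (w := e.symm 4) (by simp) (by simp)
    (by simp) ?_ ?_ ?_
  · rintro _ (rfl | rfl | rfl) _ (rfl | rfl | rfl) hne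
    all_goals first | exact (hne rfl).elim | (rw [hadj]; simp only [RelIso.apply_symm_apply]; decide)
  · intro i j k h1 h2 h3
    rw [hadj] at h1 h2 h3
    simpa using congrArg (Int.cast : ℤ → K) (hc _ _ _ h1 h2 h3)
  · intro β
    by_contra! h
    have h' : ∀ a b : Fin 7, a ≠ b → ¬ (SimpleGraph.cycleGraph 7).Adj a b →
        (c a b : K) = β (e.symm b) - β (e.symm a) := by
      intro a b hab h1
      have := h (e.symm a) (e.symm b) (by simpa using hab) (by rw [hadj]; simpa using h1)
      simpa using this
    have h02 := h' 0 2 (by decide) (by decide)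
    have h24 := h' 2 4 (by decide) (by decide)
    have h46 := h' 4 6 (by decide) (by decide)
    have h61 := h' 6 1 (by decide) (by decide)
    have h13 := h' 1 3 (by decide) (by decide)
    have h35 := h' 3 5 (by decide) (by decide)
    have h50 := h' 5 0 (by decide) (by decide)
    simp [c] at h02 h24 h46 h61 h13 h35 h50
    exact one_ne_zero (α := K)
      (by linear_combination h02 + h24 + h46 + h61 + h13 + h35 + h50)

/-- Membership in a face of the independence complex of the `n`-cycle whose link is the
independence complex of the path `0, 1, 2`. -/
def pathLinkFace (n k : ℕ) : Prop :=
  -- Even `n`: 4, 6, …, n - 2. Odd `n ≥ 9`: 4, 7, 9, …, n - 2, where the gap of three fixes the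
  -- parity. For `n = 7` only 4 remains and vertex 6 stays in the link.
  if n % 2 = 0 then k % 2 = 0 ∧ 4 ≤ k ∧ k + 2 ≤ n else k = 4 ∨ (k % 2 = 1 ∧ 7 ≤ k ∧ k + 2 ≤ n)

/-- Every vertex beyond 0, 1, 2 lies in the face or next to it, so the link is the edge `{0, 2}`
plus the isolated point 1. -/
theorem not_cohenMacaulay_of_iso_cycleGraph (hn : 6 ≤ n) (hn7 : n ≠ 7)
    (e : D.underlyingGraph ≃g SimpleGraph.cycleGraph n) : ¬ D.CohenMacaulay K := by
  have hadj : ∀ i j, D.underlyingGraph.Adj i j ↔ (e i).1 + 1 = (e j).1 ∨ (e j).1 + 1 = (e i).1 ∨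
      ((e i).1 = 0 ∧ (e j).1 + 1 = n) ∨ ((e j).1 = 0 ∧ (e i).1 + 1 = n) :=
    fun i j => by rw [← SimpleGraph.cycleGraph_adj_iff_val (by omega)]; exact e.map_adj_iff.symm
  have hlt : ∀ i, (e i).1 < n := fun i => (e i).2
  have hσ : ∀ i j, pathLinkFace n (e i).1 → pathLinkFace n (e j).1 →
      ¬ D.underlyingGraph.Adj i j := by
    intro i j hi hj
    rw [hadj]
    unfold pathLinkFace at hi hj
    split_ifs at hi hj <;> omega
  have hlow : ∀ i j, (e i).1 ≤ 2 → pathLinkFace n (e j).1 → ¬ D.underlyingGraph.Adj i j := by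
    intro i j hi hj
    rw [hadj]
    unfold pathLinkFace at hj
    split_ifs at hj <;> omega
  have hnot : ∀ i, (e i).1 ≤ 2 → ¬ pathLinkFace n (e i).1 := by
    intro i hi
    unfold pathLinkFace
    split_ifs <;> omega
  have hfar : ∀ i, 3 ≤ (e i).1 → ¬ pathLinkFace n (e i).1 →
      ∃ j, pathLinkFace n (e j).1 ∧ D.underlyingGraph.Adj i j := by
    intro i hi hi'
    have := hlt i
    obtain ⟨k, hk, hk', hk''⟩ : ∃ k, k < n ∧ pathLinkFace n k ∧
        ((e i).1 + 1 = k ∨ k + 1 = (e i).1) := by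
      unfold pathLinkFace at hi' ⊢
      split_ifs at hi' ⊢
      · by_cases h : (e i).1 = 3
        · exact ⟨4, by omega⟩
        · exact ⟨(e i).1 - 1, by omega⟩
      · by_cases h : (e i).1 = 3 ∨ (e i).1 = 6
        · exact ⟨(e i).1 + 1, by omega⟩
        · exact ⟨(e i).1 - 1, by omega⟩
    exact ⟨e.symm ⟨k, hk⟩, by simpa using hk', by rw [hadj]; simp; omega⟩
  refine not_cohenMacaulay_of_disconnected (σ := {v | pathLinkFace n (e v).1})
    (c := fun v => if (e v).1 = 1 then 1 else 0)
    (u := e.symm ⟨0, by omega⟩) (v := e.symm ⟨2, by omega⟩) (w := e.symm ⟨1, by omega⟩)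
    ?_ ?_ (hnot _ (by simp)) (hnot _ (by simp)) (hnot _ (by simp)) (by simp) (by simp) ?_
  · have h02 : ¬ D.underlyingGraph.Adj (e.symm ⟨0, by omega⟩) (e.symm ⟨2, by omega⟩) := by
      rw [hadj]; simp; omega
    rintro i (rfl | rfl | hi) j (rfl | rfl | hj) hne
    · exact (hne rfl).elim
    · exact h02
    · exact hlow _ _ (by simp) hj
    · exact fun h => h02 h.symm
    · exact (hne rfl).elim
    · exact hlow _ _ (by simp) hj
    · exact fun h => hlow _ _ (by simp) hi h.symm
    · exact fun h => hlow _ _ (by simp) hi h.symm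
    · exact hσ _ _ hi hj
  · rintro i (rfl | hi) j (rfl | hj) hne
    · exact (hne rfl).elim
    · exact hlow _ _ (by simp) hj
    · exact fun h => hlow _ _ (by simp) hi h.symm
    · exact hσ _ _ hi hj
  · intro i j hi hj hi' hj' hij
    have h2 : ∀ i, ¬ pathLinkFace n (e i).1 →
        (∀ s ∈ {v | pathLinkFace n (e v).1}, ¬ D.underlyingGraph.Adj i s) → (e i).1 ≤ 2 := by
      intro i hi hi'
      by_contra! h
      obtain ⟨j, hj, hj'⟩ := hfar i h hi
      exact hi' j hj hj'
    have hi2 := h2 i hi hi'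
    have hj2 := h2 j hj hj'
    rw [hadj] at hij
    have : (e i).1 = 1 ↔ (e j).1 = 1 := by omega
    simp only [this]

end WeightedOrientedGraph

theorem proposition4p2 {V : Type*} [Finite V] (K : Type*) [Field K]
    (D : WeightedOrientedGraph V)
    (hcycle : ∃ n : ℕ, 3 ≤ n ∧ Nonempty (D.underlyingGraph ≃g SimpleGraph.cycleGraph n))
    (hCM : D.CohenMacaulay K) :
    Nonempty (D.underlyingGraph ≃g SimpleGraph.cycleGraph 3) ∨
      Nonempty (D.underlyingGraph ≃g SimpleGraph.cycleGraph 5) := by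
  obtain ⟨n, hn, ⟨e⟩⟩ := hcycle
  rcases (by omega : n = 3 ∨ n = 4 ∨ n = 5 ∨ n = 7 ∨ (6 ≤ n ∧ n ≠ 7)) with
    rfl | rfl | rfl | rfl | ⟨h6, h7⟩
  · exact Or.inl ⟨e⟩
  · exact (WeightedOrientedGraph.not_cohenMacaulay_of_iso_cycleGraph_four e hCM).elim
  · exact Or.inr ⟨e⟩
  · exact (WeightedOrientedGraph.not_cohenMacaulay_of_iso_cycleGraph_seven e hCM).elim
  · exact (WeightedOrientedGraph.not_cohenMacaulay_of_iso_cycleGraph h6 h7 e hCM).elim
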